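/- Let $n\ge 1$, and for a multi-index $\alpha=(\alpha_1,\dots,\alpha_n)$ of non-negative integers write $z^\alpha=z_1^{\alpha_1}\cdots z_n^{\alpha_n}$, $z\in\mathbb C^n$. For a complete $n$-circular (Reinhardt) domain $D\subset\mathbb C^n$ let $B_n(D)$ be the largest number (the supremum of all numbers) $r\ge 0$ with the following property: whenever a power series $\sum_\alpha c_\alpha z^\alpha$ with complex coefficients converges at every point of $D$ and satisfies $\left|\sum_\alpha c_\alpha z^\alpha\right|<1$ for all $z\in D$, then $$\sum_\alpha \sup_{z\in rD}|c_\alpha z^\alpha|<1,$$ where $rD=\{rz: z\in D\}$. **Theorem 5.** Let $D^1=\{z\in\mathbb C^n: |z_1|^2+\dots+|z_n|^2<1\}$ be the unit ball. Then $$B_n(D^1)>\frac{2}{5n}\quad\text{for every } n>1,$$ and there is an integer $N$ such that $$B_n(D^1)>\frac{1}{2n}\quad\text{for all } n\ge N.$$ -/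

import Mathlib

namespace Bohr

open scoped ENNReal Pointwise

/-- The monomial `z ^ α = z₁ ^ α₁ ⋯ zₙ ^ αₙ`, with `0 ^ 0 = 1`. -/
def monomial {n : ℕ} (α : Fin n → ℕ) (z : Fin n → ℂ) : ℂ :=
  ∏ i, z i ^ α i

/-- The power series `∑ c_α z ^ α` converges at every point of `D`. Convergence of a multiple
series is unordered, hence absolute. -/
def ConvergesOn {n : ℕ} (c : (Fin n → ℕ) → ℂ) (D : Set (Fin n → ℂ)) : Prop :=
  ∀ z ∈ D, Summable fun α => c α * monomial α z

/-- The sum of the power series has modulus less than `1` at every point of `D`. -/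
def SumLtOneOn {n : ℕ} (c : (Fin n → ℕ) → ℂ) (D : Set (Fin n → ℂ)) : Prop :=
  ∀ z ∈ D, ‖∑' α, c α * monomial α z‖ < 1

/-- The sum over all multi-indices `α` of `sup_D |c_α z ^ α|`, with values in `[0, ∞]`. -/
noncomputable def supSum {n : ℕ} (c : (Fin n → ℕ) → ℂ) (D : Set (Fin n → ℂ)) : ℝ≥0∞ :=
  ∑' α, ⨆ z ∈ D, ‖c α * monomial α z‖ₑ

/-- The numbers `r ≥ 0` such that every power series that converges in `D`, with sum of modulus
less than `1` there, satisfies `∑ sup_{r D} |c_α z ^ α| < 1`. -/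
def admissibleRadii {n : ℕ} (D : Set (Fin n → ℂ)) : Set ℝ :=
  {r | 0 ≤ r ∧ ∀ c : (Fin n → ℕ) → ℂ,
    ConvergesOn c D → SumLtOneOn c D → supSum c (r • D) < 1}

/-- The Bohr radius `B_n(D)`. -/
noncomputable def bohrRadius {n : ℕ} (D : Set (Fin n → ℂ)) : ℝ :=
  sSup (admissibleRadii D)

/-- The open Euclidean unit ball of `ℂⁿ`. -/
def unitBall (n : ℕ) : Set (Fin n → ℂ) :=
  {z | ∑ i, ‖z i‖ ^ 2 < 1}

end Bohr

/-!
The proof compares the power series `f = ∑ c_α z ^ α`, bounded by `1` on the unit ball of `ℂⁿ`,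
with a geometric series in `n` variables. Put `a = ‖c 0‖ < 1`.

Restricting `f` to the circles `u ↦ (u ^ m₁ z₁, …, u ^ mₙ zₙ)`, which stay in the ball, and
integrating against the density `1 + Re (v u⁻ᵏ)` gives Carathéodory's inequality
(`norm_coeff_le`): each part of positive weighted degree is at most `2 (1 - a)` on the ball. This
is used twice. With weights that isolate a given `α` (`exists_weights`), it bounds every single
term by `2 (1 - a)` (`norm_term_le`). With all weights equal to `1`, it bounds the linear part, and
evaluating the linear part near the boundary point whose coordinates all have modulus `1 / √n`
gives `∑ ‖c_j‖ ≤ √n * 2 (1 - a)` (`sum_norm_linear_le`), much better than the `n * 2 (1 - a)`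
obtained term by term.

Since `∑_α r ^ |α| = (1 - r)⁻ⁿ`, the sum of the suprema over the ball of radius `r` is at most
`a + 2 (1 - a) ((1 - r)⁻ⁿ - 1 - n r + √n r)`, which is below `1` as soon as the last bracket is below
`1 / 2` (`supSum_lt_one`). For `r = θ / n`, Bernoulli's inequality bounds the bracket by
`(1 - θ / 2)⁻² - 1 - θ + θ / √n`, and there is room to take `θ = 41 / 100 > 2 / 5` for all `n ≥ 2`
and `θ = 51 / 100 > 1 / 2` for all `n ≥ 16`.
-/

open scoped ENNReal Pointwise ComplexConjugate
open Complex MeasureTheory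

namespace Bohr

/-! ### Coefficients of series on the circle -/

lemma integral_exp_int_mul_I (m : ℤ) :
    ∫ t in (0 : ℝ)..2 * Real.pi, exp ((m : ℂ) * I * t) =
      if m = 0 then ((2 * Real.pi : ℝ) : ℂ) else 0 := by
  split_ifs with h
  · simp [h]
  · rw [integral_exp_mul_complex (mul_ne_zero (by exact_mod_cast h) I_ne_zero)]
    have : (m : ℂ) * I * ((2 * Real.pi : ℝ) : ℂ) = m * (2 * Real.pi * I) := by push_cast; ring
    rw [this, exp_int_mul_two_pi_mul_I]
    simp

/-- The kernel `1 + Re (u e^{-ikt})`, written through exponentials. -/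
noncomputable def kernel (u : ℂ) (k : ℕ) (t : ℝ) : ℂ :=
  1 + (u * exp (((-k : ℤ) : ℂ) * I * t) + conj u * exp (((k : ℤ) : ℂ) * I * t)) / 2

lemma continuous_kernel (u : ℂ) (k : ℕ) : Continuous (kernel u k) := by
  unfold kernel; fun_prop

/-- For `‖u‖ = 1` the kernel is real and nonnegative. -/
lemma kernel_eq_norm {u : ℂ} (hu : ‖u‖ = 1) (k : ℕ) (t : ℝ) :
    kernel u k t = (‖kernel u k t‖ : ℂ) := by
  have hexp : exp (((k : ℤ) : ℂ) * I * t) = conj (exp (((-k : ℤ) : ℂ) * I * t)) := by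
    rw [← exp_conj]; simp
  have hv : ‖u * exp (((-k : ℤ) : ℂ) * I * t)‖ = 1 := by
    rw [norm_mul, hu, one_mul]
    have : ((-k : ℤ) : ℂ) * I * t = ((-k * t : ℝ) : ℂ) * I := by push_cast; ring
    rw [this, norm_exp_ofReal_mul_I]
  have hre : kernel u k t = ((1 + (u * exp (((-k : ℤ) : ℂ) * I * t)).re : ℝ) : ℂ) := by
    unfold kernel
    rw [hexp, ← map_mul, add_conj]
    push_cast; ring
  have hnn : 0 ≤ 1 + (u * exp (((-k : ℤ) : ℂ) * I * t)).re := by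
    have := (abs_le.mp (abs_re_le_norm (u * exp (((-k : ℤ) : ℂ) * I * t)))).1
    rw [hv] at this
    linarith
  rw [hre, norm_real, Real.norm_of_nonneg hnn]

lemma integral_exp_mul_kernel (u : ℂ) {k : ℕ} (hk : k ≠ 0) (w : ℕ) :
    ∫ t in (0 : ℝ)..2 * Real.pi, exp (t * I) ^ w * kernel u k t =
      ((2 * Real.pi : ℝ) : ℂ) * ((if w = 0 then 1 else 0) + u / 2 * if w = k then 1 else 0) := by
  have h : ∀ t : ℝ, exp (t * I) ^ w * kernel u k t =
      exp (((w : ℤ) : ℂ) * I * t) + u / 2 * exp (((w - k : ℤ) : ℂ) * I * t) +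
        conj u / 2 * exp (((w + k : ℤ) : ℂ) * I * t) := by
    intro t
    have h1 : exp (t * I) ^ w = exp (((w : ℤ) : ℂ) * I * t) := by
      rw [← exp_nat_mul]; congr 1; push_cast; ring
    have h2 : exp (((w - k : ℤ) : ℂ) * I * t) =
        exp (((w : ℤ) : ℂ) * I * t) * exp (((-k : ℤ) : ℂ) * I * t) := by
      rw [← exp_add]; congr 1; push_cast; ring
    have h3 : exp (((w + k : ℤ) : ℂ) * I * t) =
        exp (((w : ℤ) : ℂ) * I * t) * exp (((k : ℤ) : ℂ) * I * t) := by
      rw [← exp_add]; congr 1; push_cast; ring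
    rw [h1, h2, h3, kernel]; ring
  have hint : ∀ (a : ℂ) (m : ℤ), IntervalIntegrable (fun t : ℝ => a * exp ((m : ℂ) * I * t))
      volume 0 (2 * Real.pi) := fun a m => by
    apply Continuous.intervalIntegrable; fun_prop
  have hint1 : ∀ (m : ℤ), IntervalIntegrable (fun t : ℝ => exp ((m : ℂ) * I * t))
      volume 0 (2 * Real.pi) := fun m => by
    apply Continuous.intervalIntegrable; fun_prop
  simp_rw [h]
  rw [intervalIntegral.integral_add ((hint1 _).add (hint _ _)) (hint _ _),
    intervalIntegral.integral_add (hint1 _) (hint _ _),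
    intervalIntegral.integral_const_mul, intervalIntegral.integral_const_mul,
    integral_exp_int_mul_I, integral_exp_int_mul_I, integral_exp_int_mul_I]
  have e1 : ((w : ℤ) = 0) ↔ w = 0 := by omega
  have e2 : ((w : ℤ) - k = 0) ↔ w = k := by omega
  have e3 : ¬ ((w : ℤ) + k = 0) := by omega
  simp only [e1, e2, e3, if_false]
  split_ifs <;> ring

/-- A rotation of `y` aligns it with `x`. -/
lemma exists_norm_add_mul_eq (x y : ℂ) : ∃ u : ℂ, ‖u‖ = 1 ∧ ‖x + u * y‖ = ‖x‖ + ‖y‖ := by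
  refine ⟨exp ((arg x - arg y : ℝ) * I), norm_exp_ofReal_mul_I _, ?_⟩
  have he : exp (arg x * I) = exp ((arg x - arg y : ℝ) * I) * exp (arg y * I) := by
    rw [← exp_add]; congr 1; push_cast; ring
  have hx : x + exp ((arg x - arg y : ℝ) * I) * y =
      ((‖x‖ + ‖y‖ : ℝ) : ℂ) * exp (arg x * I) := by
    have h1 := norm_mul_exp_arg_mul_I x
    have h2 := norm_mul_exp_arg_mul_I y
    rw [ofReal_add]
    linear_combination -h1 - exp ((arg x - arg y : ℝ) * I) * h2 - (‖y‖ : ℂ) * he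
  rw [hx, norm_mul, norm_exp_ofReal_mul_I, mul_one, norm_real, Real.norm_of_nonneg (by positivity)]

/-- Carathéodory's inequality for an absolutely summable family of monomials `b i * u ^ w i` whose
sum is bounded by `1` on the unit circle: the coefficient `B k` of `u ^ k` satisfies
`‖B 0‖ + ‖B k‖ / 2 ≤ 1`, because `B 0 + v * B k / 2` is the mean of the sum against the
probability density `1 + Re (v u⁻ᵏ)`. -/
lemma norm_coeff_le {ι : Type*} [Countable ι] {b : ι → ℂ} {w : ι → ℕ} (hb : Summable b)
    (h : ∀ u : ℂ, ‖u‖ = 1 → ‖∑' i, b i * u ^ w i‖ ≤ 1) {k : ℕ} (hk : k ≠ 0) {B₀ Bk : ℂ}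
    (h₀ : HasSum (fun i => b i * if w i = 0 then 1 else 0) B₀)
    (hBk : HasSum (fun i => b i * if w i = k then 1 else 0) Bk) :
    ‖Bk‖ ≤ 2 * (1 - ‖B₀‖) := by
  obtain ⟨v, hv, hveq⟩ := exists_norm_add_mul_eq B₀ (Bk / 2)
  let f : ι → C(ℝ, ℂ) := fun i => ⟨fun t => b i * (exp (t * I) ^ w i * kernel v k t), by
    have := continuous_kernel v k
    fun_prop⟩
  have hpi : (0 : ℝ) < 2 * Real.pi := by positivity
  have hfsum : ∀ t : ℝ, ‖exp (t * I)‖ = 1 := norm_exp_ofReal_mul_I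
  have hS : HasSum (fun i => ∫ t in (0 : ℝ)..2 * Real.pi, f i t)
      (∫ t in (0 : ℝ)..2 * Real.pi, ∑' i, f i t) := by
    apply intervalIntegral.hasSum_integral_of_dominated_convergence
      (fun i t => ‖b i‖ * ‖kernel v k t‖)
    · exact fun i => (f i).continuous.aestronglyMeasurable
    · intro i
      refine Filter.Eventually.of_forall fun t _ => ?_
      simp [f, hfsum]
    · exact Filter.Eventually.of_forall fun t _ => hb.norm.mul_right _
    · simp_rw [tsum_mul_right]
      exact ((continuous_kernel v k).norm.const_mul _).intervalIntegrable _ _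
    · refine Filter.Eventually.of_forall fun t _ => Summable.hasSum ?_
      refine Summable.of_norm_bounded (hb.norm.mul_right ‖kernel v k t‖) fun i => ?_
      simp [f, hfsum]
  have hterm : ∀ i, ∫ t in (0 : ℝ)..2 * Real.pi, f i t = ((2 * Real.pi : ℝ) : ℂ) *
      ((b i * if w i = 0 then 1 else 0) + v / 2 * (b i * if w i = k then 1 else 0)) := by
    intro i
    simp only [f, ContinuousMap.coe_mk]
    rw [intervalIntegral.integral_const_mul, integral_exp_mul_kernel v hk]
    ring
  simp_rw [hterm] at hS
  have hval := hS.unique ((h₀.add (hBk.mul_left (v / 2))).mul_left _)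
  have hbound : ‖∫ t in (0 : ℝ)..2 * Real.pi, ∑' i, f i t‖ ≤
      ∫ t in (0 : ℝ)..2 * Real.pi, ‖kernel v k t‖ := by
    apply intervalIntegral.norm_integral_le_of_norm_le hpi.le
    · refine Filter.Eventually.of_forall fun t _ => ?_
      simp only [f, ContinuousMap.coe_mk, ← mul_assoc]
      rw [tsum_mul_right, norm_mul]
      exact mul_le_of_le_one_left (norm_nonneg _) (h _ (hfsum t))
    · exact (continuous_kernel v k).norm.intervalIntegrable _ _
  have hK : ∫ t in (0 : ℝ)..2 * Real.pi, ‖kernel v k t‖ = 2 * Real.pi := by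
    -- The kernel equals its norm, so the integral of its norm is its mean value.
    have h1 := integral_exp_mul_kernel v hk 0
    simp only [pow_zero, one_mul, if_true, hk.symm, if_false, mul_zero, add_zero, mul_one] at h1
    rw [intervalIntegral.integral_congr (fun t _ => kernel_eq_norm hv k t),
      intervalIntegral.integral_ofReal] at h1
    exact_mod_cast h1
  have heq : B₀ + v / 2 * Bk = B₀ + v * (Bk / 2) := by ring
  rw [hval, hK, norm_mul, norm_real, Real.norm_of_nonneg hpi.le, heq, hveq, norm_div] at hbound
  have h2 : ‖B₀‖ + ‖Bk‖ / ‖(2 : ℂ)‖ ≤ 1 := by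
    nlinarith
  rw [Complex.norm_two] at h2
  linarith

/-! ### Separating a monomial by weights -/

/-- For every multi-index `α` there are weights for which no other multi-index has the weighted
degree of `α`. With `M` larger than `|α|`, the weights `K + M ^ i` with `K` large make the weighted
degree determine the degree first and then, through the base `M` digits, the multi-index. -/
lemma exists_weights {n : ℕ} (α : Fin n → ℕ) :
    ∃ m : Fin n → ℕ, ∀ β : Fin n → ℕ, ∑ i, m i * β i = ∑ i, m i * α i → β = α := by
  set k := ∑ i, α i with hk
  set M := k + 2 with hM
  set K := (k + 1) * M ^ n with hK
  refine ⟨fun i => K + M ^ (i : ℕ), fun β h => ?_⟩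
  simp only [add_mul, Finset.sum_add_distrib, ← Finset.mul_sum] at h
  have hle : ∀ γ : Fin n → ℕ, ∑ i : Fin n, M ^ (i : ℕ) * γ i ≤ M ^ n * ∑ i, γ i := fun γ => by
    rw [Finset.mul_sum]
    exact Finset.sum_le_sum fun i _ => Nat.mul_le_mul_right _
      (Nat.pow_le_pow_right (by omega) i.2.le)
  have hα := hle α
  have hβ := hle β
  rw [← hk] at h hα
  set s := ∑ i, β i with hs
  have hP : 0 < M ^ n := by positivity
  have hsk : s = k := by
    rcases lt_trichotomy s k with hlt | heq | hgt
    · exfalso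
      have : K * (s + 1) ≤ K * k := Nat.mul_le_mul_left _ hlt
      rw [mul_add, mul_one] at this
      have : M ^ n * s < K := by rw [hK, mul_comm]; exact Nat.mul_lt_mul_of_pos_right (by omega) hP
      omega
    · exact heq
    · exfalso
      have : K * (k + 1) ≤ K * s := Nat.mul_le_mul_left _ hgt
      rw [mul_add, mul_one] at this
      have : M ^ n * k < K := by rw [hK, mul_comm]; exact Nat.mul_lt_mul_of_pos_right (by omega) hP
      omega
  rw [hsk] at h
  have hdig := Nat.add_left_cancel h
  have hαlt : ∀ i, α i < M := fun i => by
    have := Finset.single_le_sum (f := α) (fun _ _ => Nat.zero_le _) (Finset.mem_univ i)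
    omega
  have hβlt : ∀ i, β i < M := fun i => by
    have := Finset.single_le_sum (f := β) (fun _ _ => Nat.zero_le _) (Finset.mem_univ i)
    omega
  refine List.ofFn_inj.mp ?_
  apply Nat.ofDigits_inj_of_len_eq (b := M) (by omega) (by simp)
  · intro l hl
    obtain ⟨i, rfl⟩ := (List.mem_ofFn' _ _).mp hl
    exact hβlt i
  · intro l hl
    obtain ⟨i, rfl⟩ := (List.mem_ofFn' _ _).mp hl
    exact hαlt i
  · simpa [Nat.ofDigits_eq_sum_mapIdx, List.mapIdx_eq_ofFn, List.sum_ofFn, mul_comm] using! hdig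

/-! ### The geometric series over multi-indices -/

lemma hasSum_pow_degree (n : ℕ) {r : ℝ} (h0 : 0 ≤ r) (h1 : r < 1) :
    HasSum (fun α : Fin n → ℕ => r ^ ∑ i, α i) ((1 - r)⁻¹ ^ n) := by
  induction n with
  | zero => simp
  | succ n ih =>
    rw [← (Fin.consEquiv (fun _ : Fin (n + 1) => ℕ)).hasSum_iff, pow_succ']
    have hg := hasSum_geometric_of_lt_one h0 h1
    have hs : Summable fun x : ℕ × (Fin n → ℕ) => r ^ x.1 * r ^ ∑ i, x.2 i :=
      Summable.mul_of_nonneg (f := fun k : ℕ => r ^ k) (g := fun α : Fin n → ℕ => r ^ ∑ i, α i)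
        hg.summable ih.summable (fun k => pow_nonneg h0 _) (fun α => pow_nonneg h0 _)
    have heq : (fun α : Fin (n + 1) → ℕ => r ^ ∑ i, α i) ∘ Fin.consEquiv (fun _ => ℕ) =
        fun x : ℕ × (Fin n → ℕ) => r ^ x.1 * r ^ ∑ i, x.2 i := by
      funext x
      simp [Fin.consEquiv, Fin.sum_univ_succ, pow_add]
    rw [heq]
    exact HasSum.mul (f := fun k : ℕ => r ^ k) (g := fun α : Fin n → ℕ => r ^ ∑ i, α i) hg ih hs

/-! ### Coefficient bounds on the ball -/

variable {n : ℕ}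

lemma monomial_weighted (α m : Fin n → ℕ) (u : ℂ) (z : Fin n → ℂ) :
    monomial α (fun i => u ^ m i * z i) = monomial α z * u ^ ∑ i, m i * α i := by
  simp only [monomial, mul_pow, Finset.prod_mul_distrib, ← pow_mul, Finset.prod_pow_eq_pow_sum]
  ring

lemma monomial_smul (α : Fin n → ℕ) (r : ℝ) (z : Fin n → ℂ) :
    monomial α (r • z) = (r : ℂ) ^ (∑ i, α i) * monomial α z := by
  simp [monomial, mul_pow, Finset.prod_mul_distrib, Finset.prod_pow_eq_pow_sum]

lemma monomial_zero (z : Fin n → ℂ) : monomial 0 z = 1 := by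
  simp [monomial]

lemma monomial_single (j : Fin n) (z : Fin n → ℂ) : monomial (Pi.single j 1) z = z j := by
  rw [monomial, Finset.prod_eq_single j] <;> simp +contextual

lemma weighted_mem_unitBall {z : Fin n → ℂ} (hz : z ∈ unitBall n) (m : Fin n → ℕ) {u : ℂ}
    (hu : ‖u‖ = 1) : (fun i => u ^ m i * z i) ∈ unitBall n := by
  simpa [unitBall, hu] using hz

lemma norm_apply_le_one {z : Fin n → ℂ} (hz : z ∈ unitBall n) (j : Fin n) : ‖z j‖ ≤ 1 := by
  have h := Finset.single_le_sum (f := fun i => ‖z i‖ ^ 2) (fun _ _ => sq_nonneg _)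
    (Finset.mem_univ j)
  have h' : ∑ i, ‖z i‖ ^ 2 < 1 := hz
  exact (sq_le_one_iff₀ (norm_nonneg _)).mp (h.trans h'.le)

lemma single_one_injective : Function.Injective fun j : Fin n => (Pi.single j 1 : Fin n → ℕ) := by
  intro i j hij
  by_contra hne
  have := congrFun hij i
  simp [hne] at this

lemma exists_eq_single_of_sum_eq_one {β : Fin n → ℕ} (h : ∑ i, β i = 1) :
    ∃ j, β = Pi.single j 1 := by
  obtain ⟨j, -, hj⟩ : ∃ j ∈ Finset.univ, β j ≠ 0 := by
    apply Finset.exists_ne_zero_of_sum_ne_zero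
    rw [h]; exact one_ne_zero
  refine ⟨j, funext fun i => ?_⟩
  rw [← Finset.add_sum_erase _ _ (Finset.mem_univ j)] at h
  rcases eq_or_ne i j with rfl | hij
  · simp; omega
  · have := Finset.single_le_sum (f := β) (fun _ _ => Nat.zero_le _)
      (Finset.mem_erase.mpr ⟨hij, Finset.mem_univ i⟩)
    simp [hij]; omega

/-- The bound on the part of weighted degree `k ≠ 0` of the series, for weights under which only the
constant term has degree zero. -/
lemma norm_weighted_part_le {c : (Fin n → ℕ) → ℂ} (hc : ConvergesOn c (unitBall n))
    (hs : SumLtOneOn c (unitBall n)) {z : Fin n → ℂ} (hz : z ∈ unitBall n) (m : Fin n → ℕ)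
    (hm : ∀ β : Fin n → ℕ, ∑ i, m i * β i = 0 → β = 0) {k : ℕ} (hk : k ≠ 0) {B : ℂ}
    (hB : HasSum (fun β => c β * monomial β z * if ∑ i, m i * β i = k then 1 else 0) B) :
    ‖B‖ ≤ 2 * (1 - ‖c 0‖) := by
  refine norm_coeff_le (hc z hz) (fun u hu => ?_) hk ?_ hB
  · have h := (hs _ (weighted_mem_unitBall hz m hu)).le
    simpa only [monomial_weighted, mul_assoc] using h
  · convert hasSum_single (0 : Fin n → ℕ) ?_ using 1
    · simp [monomial_zero]
    · intro β hβ
      rw [if_neg fun h => hβ (hm β h), mul_zero]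

/-- Every nonconstant term of the series is at most `2 (1 - ‖c 0‖)` on the ball. -/
lemma norm_term_le {c : (Fin n → ℕ) → ℂ} (hc : ConvergesOn c (unitBall n))
    (hs : SumLtOneOn c (unitBall n)) {z : Fin n → ℂ} (hz : z ∈ unitBall n) {α : Fin n → ℕ}
    (hα : α ≠ 0) :
    ‖c α * monomial α z‖ ≤ 2 * (1 - ‖c 0‖) := by
  obtain ⟨m, hm⟩ := exists_weights α
  refine norm_weighted_part_le hc hs hz m (fun β hβ => ?_) (k := ∑ i, m i * α i) (fun h => ?_) ?_
  -- If `β` has weight zero, then `α + β` has the weight of `α`.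
  · have := hm (α + β) (by simp [mul_add, Finset.sum_add_distrib, hβ])
    simpa using this
  · exact hα (hm 0 (by simp [h])).symm
  · convert hasSum_single α ?_ using 1
    · simp
    · intro β hβ
      rw [if_neg fun h => hβ (hm β h), mul_zero]

/-- The `ℓ¹` bound on the linear coefficients: the linear part is at most `2 (1 - ‖c 0‖)` at the
points whose coordinates have modulus `t / √n`, `t < 1`, and arguments opposite to those of the
coefficients. -/
lemma sum_norm_linear_le {c : (Fin n → ℕ) → ℂ} (hc : ConvergesOn c (unitBall n))
    (hs : SumLtOneOn c (unitBall n)) (hn : 0 < n) :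
    ∑ j, ‖c (Pi.single j 1)‖ ≤ √n * (2 * (1 - ‖c 0‖)) := by
  have hn' : (0 : ℝ) < √n := by positivity
  have hsq : √(n : ℝ) ^ 2 = n := Real.sq_sqrt n.cast_nonneg
  set X := ∑ j, ‖c (Pi.single j 1)‖ with hX
  have key : ∀ t : ℝ, 0 < t → t < 1 → t * X ≤ √n * (2 * (1 - ‖c 0‖)) := by
    intro t ht ht1
    let z : Fin n → ℂ := fun j => (t / √n : ℝ) * exp (-(arg (c (Pi.single j 1)) : ℝ) * I)
    have hzn : ∀ j, ‖z j‖ = t / √n := fun j => by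
      have : -((arg (c (Pi.single j 1)) : ℝ) : ℂ) * I =
        ((-arg (c (Pi.single j 1)) : ℝ) : ℂ) * I := by push_cast; ring
      simp only [z]
      rw [this, norm_mul, norm_exp_ofReal_mul_I, norm_real, Real.norm_of_nonneg (by positivity),
        mul_one]
    have hz : z ∈ unitBall n := by
      show ∑ i, ‖z i‖ ^ 2 < 1
      simp only [hzn, div_pow, hsq, Finset.sum_const, Finset.card_univ, Fintype.card_fin,
        nsmul_eq_mul]
      rw [mul_div_cancel₀ _ (by positivity)]
      nlinarith
    have hcz : ∀ j, c (Pi.single j 1) * z j = ((t / √n * ‖c (Pi.single j 1)‖ : ℝ) : ℂ) := by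
      intro j
      have h1 := norm_mul_exp_arg_mul_I (c (Pi.single j 1))
      have h2 : exp (arg (c (Pi.single j 1)) * I) *
          exp (-(arg (c (Pi.single j 1)) : ℝ) * I) = 1 := by
        rw [← exp_add]; simp
      simp only [z]
      rw [ofReal_mul]
      linear_combination -((t / √n : ℝ) : ℂ) * exp (-(arg (c (Pi.single j 1)) : ℝ) * I) * h1 +
        ((t / √n : ℝ) : ℂ) * (‖c (Pi.single j 1)‖ : ℂ) * h2
    have hB := norm_weighted_part_le hc hs hz 1 (fun β h => by
      funext i; simpa using (Finset.sum_eq_zero_iff.mp h) i (Finset.mem_univ i)) one_ne_zero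
      (B := ∑ j, c (Pi.single j 1) * z j) (by
        rw [← (single_one_injective (n := n)).hasSum_iff]
        · convert! hasSum_fintype (fun j => c (Pi.single j 1) * z j) using 2 with j
          simp [monomial_single]
        · intro β hβ
          rw [if_neg, mul_zero]
          intro h
          obtain ⟨j, rfl⟩ := exists_eq_single_of_sum_eq_one (β := β) (by simpa using h)
          exact hβ ⟨j, rfl⟩)
    simp only [hcz] at hB
    rw [← ofReal_sum, ← Finset.mul_sum, norm_real, Real.norm_of_nonneg (by positivity),
      div_mul_eq_mul_div, div_le_iff₀ hn'] at hB
    linarith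
  have hY : 0 ≤ √n * (2 * (1 - ‖c 0‖)) := by
    have := key (1 / 2) (by norm_num) (by norm_num)
    have : 0 ≤ X := by positivity
    linarith
  by_contra! hlt
  have hXpos : 0 < X := hY.trans_lt hlt
  -- A value of `t` strictly between the quotient of the two sides and `1`.
  have h := key ((X + √n * (2 * (1 - ‖c 0‖))) / (2 * X)) (by positivity)
    (by rw [div_lt_one (by positivity)]; linarith)
  have h2 : (X + √n * (2 * (1 - ‖c 0‖))) / (2 * X) * X = (X + √n * (2 * (1 - ‖c 0‖))) / 2 := by
    field_simp
  linarith

lemma norm_const_lt_one {c : (Fin n → ℕ) → ℂ} (hs : SumLtOneOn c (unitBall n)) : ‖c 0‖ < 1 := by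
  have h0 : (0 : Fin n → ℂ) ∈ unitBall n := by simp [unitBall]
  have h := hs 0 h0
  rwa [tsum_eq_single (0 : Fin n → ℕ), monomial_zero, mul_one] at h
  intro β hβ
  obtain ⟨i, hi⟩ := Function.ne_iff.mp hβ
  rw [monomial, Finset.prod_eq_zero (Finset.mem_univ i), mul_zero]
  simpa using hi

/-- The majorant of the sum of suprema: the constant and the linear terms are estimated separately,
all others by `2 (1 - ‖c 0‖) r ^ |α|`. -/
lemma supSum_lt_one {c : (Fin n → ℕ) → ℂ} (hc : ConvergesOn c (unitBall n))
    (hs : SumLtOneOn c (unitBall n)) (hn : 0 < n) {r : ℝ} (h0 : 0 < r) (h1 : r < 1)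
    (hr : (1 - r)⁻¹ ^ n - 1 - n * r + √n * r < 1 / 2) : supSum c (r • unitBall n) < 1 := by
  have ha := norm_const_lt_one hs
  have hlin := sum_norm_linear_le hc hs hn
  set a := ‖c 0‖ with ha'
  -- The bound `2 (1 - a) r ^ |α|`, corrected at the constant and the linear multi-indices.
  let g : (Fin n → ℕ) → ℝ := fun α => 2 * (1 - a) * r ^ (∑ i, α i) +
    (if α = 0 then a - 2 * (1 - a) else 0) +
    ∑ j, if α = Pi.single j 1 then r * ‖c (Pi.single j 1)‖ - 2 * (1 - a) * r else 0
  have hg : HasSum g (2 * (1 - a) * (1 - r)⁻¹ ^ n + (a - 2 * (1 - a)) +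
      ∑ j, (r * ‖c (Pi.single j 1)‖ - 2 * (1 - a) * r)) :=
    (((hasSum_pow_degree n h0.le h1).mul_left _).add (hasSum_ite_eq 0 _)).add
      (hasSum_sum fun j _ => hasSum_ite_eq (Pi.single j 1) _)
  have hbound : ∀ α, ∀ y ∈ unitBall n, r ^ (∑ i, α i) * ‖c α * monomial α y‖ ≤ g α := by
    intro α y hy
    rcases eq_or_ne α 0 with rfl | hα
    · have : ∀ j : Fin n, (0 : Fin n → ℕ) ≠ Pi.single j 1 := fun j h => by
        simpa using congrFun h j
      simp [g, monomial_zero, this, ha']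
    · by_cases hj : ∃ j, α = Pi.single j 1
      · obtain ⟨j, rfl⟩ := hj
        simp only [g, single_one_injective.eq_iff, if_neg hα, Finset.sum_ite_eq, Finset.mem_univ, if_true,
          monomial_single, norm_mul, Finset.sum_pi_single', pow_one]
        have := mul_le_of_le_one_right (norm_nonneg (c (Pi.single j 1))) (norm_apply_le_one hy j)
        nlinarith
      · push Not at hj
        simp only [g, if_neg hα, hj, if_false, Finset.sum_const_zero, add_zero]
        rw [mul_comm]
        exact mul_le_mul_of_nonneg_right (norm_term_le hc hs hy hα) (by positivity)
  have hgnn : ∀ α, 0 ≤ g α := fun α =>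
    le_trans (by positivity) (hbound α 0 (by simp [unitBall]))
  calc supSum c (r • unitBall n) ≤ ∑' α, ENNReal.ofReal (g α) := by
        refine ENNReal.tsum_le_tsum fun α => iSup₂_le fun z hz => ?_
        obtain ⟨y, hy, rfl⟩ := hz
        rw [← ofReal_norm]
        refine ENNReal.ofReal_le_ofReal (le_of_eq_of_le ?_ (hbound α y hy))
        simp only [monomial_smul, norm_mul, norm_pow, norm_real, Real.norm_of_nonneg h0.le]
        ring
    _ = ENNReal.ofReal (∑' α, g α) := (ENNReal.ofReal_tsum_of_nonneg hgnn hg.summable).symm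
    _ < 1 := by
        rw [hg.tsum_eq, ← ENNReal.ofReal_one]
        refine (ENNReal.ofReal_lt_ofReal_iff one_pos).mpr ?_
        rw [Finset.sum_sub_distrib, ← Finset.mul_sum]
        simp only [Finset.sum_const, Finset.card_univ, Fintype.card_fin, nsmul_eq_mul]
        have h2 := mul_le_mul_of_nonneg_left hlin h0.le
        nlinarith

/-! ### Admissible radii -/

/-- The series `z₁` shows that no admissible radius exceeds `1`; without an upper bound the supremum
defining the Bohr radius would have the default value `0`. -/
lemma bddAbove_admissibleRadii (hn : 0 < n) : BddAbove (admissibleRadii (unitBall n)) := by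
  refine ⟨1, fun r hr => ?_⟩
  obtain ⟨h0, h⟩ := hr
  let e : Fin n → ℕ := Pi.single ⟨0, hn⟩ 1
  let c : (Fin n → ℕ) → ℂ := Pi.single e 1
  have hne : ∀ z : Fin n → ℂ, ∀ β, β ≠ e → c β * monomial β z = 0 := fun z β hβ => by
    simp [c, hβ]
  have hlt : ∀ z ∈ unitBall n, ‖z ⟨0, hn⟩‖ < 1 := fun z hz => by
    have h := Finset.single_le_sum (f := fun i => ‖z i‖ ^ 2) (fun _ _ => sq_nonneg _)
      (Finset.mem_univ ⟨0, hn⟩)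
    have h' : ∑ i, ‖z i‖ ^ 2 < 1 := hz
    exact (sq_lt_one_iff₀ (norm_nonneg _)).mp (h.trans_lt h')
  have hlt1 := h c (fun z _ => (hasSum_single e (hne z)).summable) (fun z hz => by
    rw [tsum_eq_single e (hne z)]
    simpa [c, e, monomial_single] using hlt z hz)
  by_contra! hr1
  refine absurd hlt1 (not_lt.mpr ?_)
  have hmem : r • (Pi.single ⟨0, hn⟩ (r⁻¹ : ℂ) : Fin n → ℂ) ∈ r • unitBall n := by
    refine Set.smul_mem_smul_set ?_
    show ∑ i, _ < (1 : ℝ)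
    rw [Finset.sum_eq_single ⟨0, hn⟩ (by simp +contextual) (by simp)]
    simp only [Pi.single_eq_same, norm_inv, norm_real, Real.norm_of_nonneg h0]
    exact pow_lt_one₀ (by positivity) (inv_lt_one_of_one_lt₀ hr1) two_ne_zero
  refine le_trans ?_ (ENNReal.le_tsum e)
  refine le_trans (le_of_eq ?_) (le_iSup₂ (f := fun z (_ : z ∈ r • unitBall n) =>
    ‖c e * monomial e z‖ₑ) _ hmem)
  have : (r : ℂ) ≠ 0 := by
    have : r ≠ 0 := by linarith
    exact_mod_cast this
  simp [c, e, monomial_single, this]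

/-- Bernoulli's inequality with exponent `n / 2`. -/
lemma one_sub_sq_le_pow (hn : 2 ≤ n) {θ : ℝ} (h1 : θ ≤ 1) :
    (1 - θ / 2) ^ 2 ≤ (1 - θ / n) ^ n := by
  have hn2 : (2 : ℝ) ≤ n := by exact_mod_cast hn
  have hθ : θ / n ≤ 1 := by rw [div_le_one (by linarith)]; linarith
  have h := one_add_mul_self_le_rpow_one_add (s := -(θ / n)) (by linarith) (p := n / 2)
    (by linarith)
  have e : 1 + (n : ℝ) / 2 * -(θ / n) = 1 - θ / 2 := by field_simp; ring
  rw [e, ← sub_eq_add_neg] at h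
  calc (1 - θ / 2) ^ 2 ≤ ((1 - θ / n) ^ ((n : ℝ) / 2)) ^ 2 :=
        pow_le_pow_left₀ (by linarith) h 2
    _ = (1 - θ / n) ^ n := by
        rw [← Real.rpow_natCast, ← Real.rpow_mul (by linarith), ← Real.rpow_natCast]
        congr 1; push_cast; ring

lemma le_bohrRadius (hn : 2 ≤ n) {θ : ℝ} (h0 : 0 < θ) (h1 : θ < 1)
    (hθ : ((1 - θ / 2) ^ 2)⁻¹ - 1 - θ + θ / √n < 1 / 2) :
    θ / n ≤ bohrRadius (unitBall n) := by
  have hn0 : 0 < n := by omega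
  have hn2 : (2 : ℝ) ≤ n := by exact_mod_cast hn
  refine le_csSup (bddAbove_admissibleRadii hn0) ⟨by positivity, fun c hc hs => ?_⟩
  have hlt : θ / n < 1 := by rw [div_lt_one (by linarith)]; linarith
  refine supSum_lt_one hc hs hn0 (by positivity) hlt ?_
  have hb := inv_anti₀ (pow_pos (by linarith : 0 < 1 - θ / 2) 2) (one_sub_sq_le_pow hn h1.le)
  have e1 : (n : ℝ) * (θ / n) = θ := by field_simp
  have e2 : √n * (θ / n) = θ / √n := by
    have hsq : √(n : ℝ) * √n = n := Real.mul_self_sqrt (by linarith)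
    have : √(n : ℝ) ≠ 0 := by positivity
    field_simp
    rw [sq, hsq]
  rw [inv_pow, e1, e2]
  linarith

end Bohr

theorem theorem5 :
    (∀ n : ℕ, 1 < n → 2 / (5 * (n : ℝ)) < Bohr.bohrRadius (Bohr.unitBall n)) ∧
    (∃ N : ℕ, ∀ n : ℕ, N ≤ n → 1 / (2 * (n : ℝ)) < Bohr.bohrRadius (Bohr.unitBall n)) := by
  refine ⟨fun n hn => ?_, 16, fun n hn => ?_⟩
  · have hn2 : (2 : ℝ) ≤ n := by exact_mod_cast hn
    refine lt_of_lt_of_le ?_ (Bohr.le_bohrRadius (θ := 41 / 100) hn (by norm_num) (by norm_num) ?_)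
    · rw [div_lt_div_iff₀ (by positivity) (by positivity)]
      linarith
    · have hs : (7 / 5 : ℝ) ≤ √n := Real.le_sqrt_of_sq_le (by linarith)
      have := div_le_div_of_nonneg_left (by norm_num : (0 : ℝ) ≤ 41 / 100) (by norm_num) hs
      norm_num at this ⊢
      linarith
  · have hn2 : (16 : ℝ) ≤ n := by exact_mod_cast hn
    refine lt_of_lt_of_le ?_
      (Bohr.le_bohrRadius (θ := 51 / 100) (by omega) (by norm_num) (by norm_num) ?_)
    · rw [div_lt_div_iff₀ (by positivity) (by positivity)]
      linarith
    · have hs : (4 : ℝ) ≤ √n := Real.le_sqrt_of_sq_le (by linarith)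
      have := div_le_div_of_nonneg_left (by norm_num : (0 : ℝ) ≤ 51 / 100) (by norm_num) hs
      norm_num at this ⊢
      linarith
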